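/- A tree is a partially ordered set $T$ in which $\{s\in T : s<t\}$ is well ordered for every $t\in T$; the height of $t$ is the order type of this set, a level of $T$ is the set of all nodes of a given height, and a branch is a maximal chain. An Aronszajn tree is an uncountable tree all of whose levels and branches are countable. A Boolean algebra $\mathfrak A$ is called Aronszajn if there are an Aronszajn tree $T$ and a family $(a_t)_{t\in T}$ of nonzero elements of $\mathfrak A$ that generates $\mathfrak A$ as a Boolean algebra, such that $a_t\le a_s$ whenever $s\le t$, and $a_t\wedge a_s=0$ whenever $s$ and $t$ are incomparable. A tunnel in a topological space $X$ is a family $\mathscr U$ of open subsets of $X$ such that for all $U,V\in\mathscr U$ one has $U=V$ or $\overline U\subseteq V$ or $\overline V\subseteq U$, and such that $\bigcup_{U\in\mathscr U}\partial U$ is dense in $X$. Theorem. If $\mathfrak A$ is an Aronszajn Boolean algebra, then its Stone space (the space of ultrafilters on $\mathfrak A$, with the topology generated by the sets $\{x : a\in x\}$, $a\in\mathfrak A$) has no tunnel. -/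

import Mathlib

universe u v

namespace AronszajnAlgebra

/-! ### Trees -/

/-- A (set-theoretic) tree: a partial order in which the strict predecessors of every element
are well ordered. -/
class IsOrderTree (T : Type u) [PartialOrder T] : Prop where
  isWellOrder_Iio : ∀ t : T, IsWellOrder (Set.Iio t) (· < ·)

/-- The height of a node: the order type of the set of its strict predecessors. -/
noncomputable def height {T : Type u} [PartialOrder T] [IsOrderTree T] (t : T) : Ordinal.{u} :=
  haveI : IsWellOrder (Set.Iio t) (· < ·) := IsOrderTree.isWellOrder_Iio t
  Ordinal.type (fun x y : Set.Iio t => x < y)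

/-- The level of the tree at the ordinal `o`. -/
def level (T : Type u) [PartialOrder T] [IsOrderTree T] (o : Ordinal.{u}) : Set T :=
  {t | height t = o}

/-- A branch: a maximal chain. -/
def IsBranch {T : Type u} [PartialOrder T] (b : Set T) : Prop :=
  IsMaxChain (· ≤ ·) b

/-- An Aronszajn tree: an uncountable tree all of whose levels and branches are countable. -/
class IsAronszajnTree (T : Type u) [PartialOrder T] : Prop extends IsOrderTree T where
  uncountable : Uncountable T
  countable_level : ∀ o : Ordinal.{u}, (level T o).Countable
  countable_branch : ∀ b : Set T, IsBranch b → b.Countable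

/-! ### Aronszajn algebras -/

/-- The Boolean algebra `A` is generated by the tree `T` through the family `a` of nonzero
elements: `a` reverses the order, takes incomparable nodes to disjoint elements, and its range
generates `A` as a Boolean algebra. -/
structure IsGeneratedByTree {T : Type u} [PartialOrder T] {A : Type v} [BooleanAlgebra A]
    (a : T → A) : Prop where
  ne_bot : ∀ t, a t ≠ ⊥
  le_of_le : ∀ s t, s ≤ t → a t ≤ a s
  inf_eq_bot : ∀ s t, ¬ s ≤ t → ¬ t ≤ s → a t ⊓ a s = ⊥
  closure_eq_top : BooleanSubalgebra.closure (Set.range a) = ⊤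

/-- A Boolean algebra is Aronszajn if it is generated by an Aronszajn tree. -/
def IsAronszajnAlgebra (A : Type v) [BooleanAlgebra A] : Prop :=
  ∃ (T : Type u) (_ : PartialOrder T) (_ : IsAronszajnTree T) (a : T → A), IsGeneratedByTree a

/-! ### Stone spaces -/

/-- The points of the Stone space of `A`: the ultrafilters on `A`, that is, the filters that
contain exactly one of `a`, `aᶜ` for every `a`. -/
structure StoneSpace (A : Type v) [BooleanAlgebra A] where
  filter : Order.PFilter A
  compl_mem_iff : ∀ a : A, aᶜ ∈ filter ↔ a ∉ filter

/-- The basic set of all ultrafilters that contain `a`. -/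
def StoneSpace.basic {A : Type v} [BooleanAlgebra A] (a : A) : Set (StoneSpace A) :=
  {x | a ∈ x.filter}

/-- The Stone topology. -/
instance StoneSpace.instTopologicalSpace (A : Type v) [BooleanAlgebra A] :
    TopologicalSpace (StoneSpace A) :=
  TopologicalSpace.generateFrom (Set.range StoneSpace.basic)

/-! ### Tunnels -/

/-- The order on the open sets of `X`: `U ≤ V` if `closure U ⊆ V` or `U = V`. -/
def OpenLE {X : Type v} [TopologicalSpace X] (U V : Set X) : Prop :=
  closure U ⊆ V ∨ U = V

/-- A chain of open sets: a family of open sets that is linearly ordered by `OpenLE`. -/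
def IsOpenChain {X : Type v} [TopologicalSpace X] (𝓤 : Set (Set X)) : Prop :=
  (∀ U ∈ 𝓤, IsOpen U) ∧ ∀ U ∈ 𝓤, ∀ V ∈ 𝓤, OpenLE U V ∨ OpenLE V U

/-- A tunnel: a chain of open sets whose boundaries have a dense union. -/
def IsTunnel {X : Type v} [TopologicalSpace X] (𝓤 : Set (Set X)) : Prop :=
  IsOpenChain 𝓤 ∧ Dense (⋃ U ∈ 𝓤, frontier U)

/-- The space `X` has a tunnel. -/
def HasTunnel (X : Type v) [TopologicalSpace X] : Prop :=
  ∃ 𝓤 : Set (Set X), IsTunnel 𝓤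

end AronszajnAlgebra

/-!
Identify a point `x` of the Stone space with its path `{t | a t ∈ x.filter}`, an initial chain of
the tree, and let `N t = basic (a t)`. Since chains and levels of the tree are countable, the space
is first countable (`IsGeneratedByTree.firstCountableTopology`); together with compactness this
forces every subfamily of a chain of open sets to have countable cofinality and coinitiality
(`IsOpenChain.exists_countable_cofinal`, `IsOpenChain.exists_countable_coinitial`). Moreover, if
`closure U ⊆ V`, then a clopen set lies between `U` and `V`, and as it involves only finitely many
generators, all but countably many nodes `s` satisfy `N s ⊆ V` or `N s ∩ U = ∅`
(`IsGeneratedByTree.exists_finset_separating`).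

Let `𝓤` be a tunnel. For each node `s`, choose countable cofinal subsets of `{U ∈ 𝓤 | N s ⊈ U}` and,
for each chosen `V`, of `{U ∈ 𝓤 | U ⊊ V}`; make the dual choices for `{U ∈ 𝓤 | N s ∩ U ≠ ∅}`. Closing
off under these choices and the corresponding finite sets of nodes gives a countable set `M` of nodes
and a node `t ∉ M` with all predecessors in `M` (`IsGeneratedByTree.exists_limit_node`). The closed
set `E = ⋂ s < t, N s` has a boundary point `x`, and every neighbourhood of `x` contains `N s \ E`
for some `s < t` (`IsGeneratedByTree.exists_boundary_point`).

By density, the boundaries of infinitely many `U ∈ 𝓤` meet `N t`. Suppose `U ⊊ U'` are two such sets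
and `x ∈ U`, so that `N s \ E ⊆ U` for some `s < t`. One of the sets `V` chosen for `s` contains
`U'` but not `N s`, and one of the sets `V' ⊊ V` chosen for `V` contains `U`. The separating set of
`V'` and `V` lies in `M`, so it decides the nodes below `t`: either `E ⊆ V` and hence `N s ⊆ V`, or
`E` misses `V' ⊇ U`, although `N t ⊆ E` meets `U`. Both are absurd. Dually, there are no two such
sets with `x` outside their closures, and at most one boundary contains `x`, so altogether at most
three members of `𝓤` have boundaries that meet `N t`.
-/

namespace AronszajnAlgebra

open Set Filter Topology

/-! ### The Stone space -/

section Stone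

variable {A : Type v} [BooleanAlgebra A]

namespace StoneSpace

theorem mem_basic {b : A} {x : StoneSpace A} : x ∈ basic b ↔ b ∈ x.filter := Iff.rfl

theorem basic_compl (b : A) : basic bᶜ = (basic b)ᶜ := by
  ext x; exact x.compl_mem_iff b

theorem basic_inf (b c : A) : basic (b ⊓ c) = basic b ∩ basic c := by
  ext x; exact Order.PFilter.inf_mem_iff

theorem basic_top : basic (⊤ : A) = univ :=
  eq_univ_of_forall fun _ => Order.PFilter.top_mem

theorem basic_bot : basic (⊥ : A) = ∅ := by
  rw [← compl_top, basic_compl, basic_top, compl_univ]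

theorem basic_sup (b c : A) : basic (b ⊔ c) = basic b ∪ basic c := by
  rw [← compl_compl (b ⊔ c), compl_sup, basic_compl, basic_inf, basic_compl, basic_compl,
    compl_inter, compl_compl, compl_compl]

theorem basic_mono {b c : A} (h : b ≤ c) : basic b ⊆ basic c := fun _ hx =>
  Order.PFilter.mem_of_le h hx

theorem isOpen_basic (b : A) : IsOpen (basic b) :=
  TopologicalSpace.isOpen_generateFrom_of_mem ⟨b, rfl⟩

theorem isClosed_basic (b : A) : IsClosed (basic b) := by
  rw [← isOpen_compl_iff, ← basic_compl]
  exact isOpen_basic _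

theorem setOf_iff_mem_nhds (b : A) (x : StoneSpace A) :
    {y : StoneSpace A | b ∈ y.filter ↔ b ∈ x.filter} ∈ 𝓝 x := by
  by_cases hb : b ∈ x.filter
  · exact mem_of_superset ((isOpen_basic b).mem_nhds hb) fun y hy => iff_of_true hy hb
  · exact mem_of_superset ((isClosed_basic b).isOpen_compl.mem_nhds hb)
      fun y hy => iff_of_false hy hb

theorem isTopologicalBasis_basic :
    TopologicalSpace.IsTopologicalBasis (range (basic (A := A))) where
  exists_subset_inter := by
    rintro _ ⟨b, rfl⟩ _ ⟨c, rfl⟩ x hx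
    exact ⟨_, ⟨b ⊓ c, rfl⟩, by rwa [basic_inf], (basic_inf b c).le⟩
  sUnion_eq := eq_univ_of_forall fun x => ⟨_, ⟨⊤, rfl⟩, Order.PFilter.top_mem⟩
  eq_generateFrom := rfl

/-- The Boolean prime ideal theorem, in the form that nonzero elements belong to ultrafilters. -/
theorem basic_nonempty {b : A} (hb : b ≠ ⊥) : (basic b).Nonempty := by
  obtain ⟨J, hJ, -, hd⟩ := DistribLattice.prime_ideal_of_disjoint_filter_ideal
    (F := Order.PFilter.principal b) (I := Order.Ideal.principal ⊥) (by
      rw [Set.disjoint_left]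
      intro c hc hc'
      have h1 : b ≤ c := hc
      have h2 : c ≤ ⊥ := hc'
      exact hb (le_bot_iff.1 (h1.trans h2)))
  have hF : Order.IsPFilter {c : A | c ∉ J} := by
    refine Order.IsPFilter.of_def ⟨⊤, hJ.toIsProper.top_notMem⟩ ?_ ?_
    · intro c hc d hd
      exact ⟨c ⊓ d, fun h => (hJ.mem_or_mem h).elim hc hd, inf_le_left, inf_le_right⟩
    · exact fun h hc hd => hc (J.lower h hd)
  have hmem : ∀ c : A, c ∈ hF.toPFilter ↔ c ∉ J := fun _ => Iff.rfl
  refine ⟨⟨hF.toPFilter, fun c => ?_⟩, ?_⟩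
  · rw [hmem, hmem, not_not]
    refine ⟨fun h => (hJ.mem_or_compl_mem (x := c)).resolve_right h, fun h h' => ?_⟩
    exact hJ.toIsProper.top_notMem (by simpa using Order.Ideal.sup_mem h h')
  · exact fun h => Set.disjoint_left.1 hd (le_refl b) h

theorem basic_subset_basic {b c : A} : basic b ⊆ basic c ↔ b ≤ c := by
  refine ⟨fun h => ?_, basic_mono⟩
  by_contra hbc
  obtain ⟨x, hx⟩ := basic_nonempty (b := b ⊓ cᶜ) fun h0 => hbc (by
    exact sdiff_eq_bot_iff.1 (sdiff_eq.trans h0))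
  rw [basic_inf, basic_compl] at hx
  exact hx.2 (h hx.1)

instance : CompactSpace (StoneSpace A) := by
  refine ⟨isCompact_iff_ultrafilter_le_nhds.2 fun 𝒢 _ => ?_⟩
  -- The ultrafilter `𝒢` of sets converges to the ultrafilter of all `b` with `basic b ∈ 𝒢`.
  have hF : Order.IsPFilter {b : A | basic b ∈ 𝒢} := by
    refine Order.IsPFilter.of_def ⟨⊤, ?_⟩ ?_ ?_
    · change basic ⊤ ∈ (𝒢 : Filter (StoneSpace A))
      rw [basic_top]
      exact univ_mem
    · intro c hc d hd
      refine ⟨c ⊓ d, ?_, inf_le_left, inf_le_right⟩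
      change basic (c ⊓ d) ∈ (𝒢 : Filter (StoneSpace A))
      rw [basic_inf]
      exact inter_mem hc hd
    · exact fun h hc => mem_of_superset hc (basic_mono h)
  have hmem : ∀ c : A, c ∈ hF.toPFilter ↔ basic c ∈ 𝒢 := fun _ => Iff.rfl
  refine ⟨⟨hF.toPFilter, fun b => ?_⟩, mem_univ _, ?_⟩
  · rw [hmem, hmem, basic_compl, Ultrafilter.compl_mem_iff_notMem]
  · rw [TopologicalSpace.nhds_generateFrom]
    refine le_iInf₂ fun s hs => ?_
    obtain ⟨hxs, b, rfl⟩ := hs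
    exact le_principal_iff.2 hxs

/-- A compact set and an open set containing it are separated by a basic clopen set. -/
theorem exists_basic_between {K V : Set (StoneSpace A)} (hK : IsCompact K) (hV : IsOpen V)
    (hKV : K ⊆ V) : ∃ b : A, K ⊆ basic b ∧ basic b ⊆ V := by
  refine hK.induction_on (p := fun K => ∃ b : A, K ⊆ basic b ∧ basic b ⊆ V) ?_ ?_ ?_ ?_
  · exact ⟨⊥, empty_subset _, by simp [basic_bot]⟩
  · rintro s t hst ⟨b, hb, hb'⟩
    exact ⟨b, hst.trans hb, hb'⟩
  · rintro s t ⟨b, hb, hb'⟩ ⟨c, hc, hc'⟩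
    refine ⟨b ⊔ c, ?_, ?_⟩ <;> rw [basic_sup]
    · exact union_subset_union hb hc
    · exact union_subset hb' hc'
  · intro x hx
    obtain ⟨_, ⟨b, rfl⟩, hxb, hb⟩ :=
      isTopologicalBasis_basic.exists_subset_of_mem_open (hKV hx) hV
    exact ⟨basic b, mem_nhdsWithin_of_mem_nhds ((isOpen_basic b).mem_nhds hxb), b, le_rfl, hb⟩

end StoneSpace

end Stone

/-! ### Countable pieces of an Aronszajn tree -/

section Tree

variable {T : Type u} [PartialOrder T]

theorem exists_minimal_notMem [IsOrderTree T] (S : Set T) {t : T} (ht : t ∉ S) :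
    ∃ r ≤ t, r ∉ S ∧ Iio r ⊆ S := by
  by_cases h : Iio t ⊆ S
  · exact ⟨t, le_rfl, ht, h⟩
  obtain ⟨q, hqt, hq⟩ := not_subset.1 h
  have := IsOrderTree.isWellOrder_Iio t
  obtain ⟨m, hm, hmin⟩ := (IsWellFounded.wf (r := ((· < ·) : Iio t → Iio t → Prop))).has_min
    {r | (r : T) ∉ S} ⟨⟨q, hqt⟩, hq⟩
  refine ⟨m, le_of_lt m.2, hm, fun p hp => ?_⟩
  by_contra hpS
  exact hmin ⟨p, lt_trans hp m.2⟩ hpS hp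

theorem isChain_Iio [IsOrderTree T] (t : T) : IsChain (· ≤ ·) (Iio t) := by
  have := IsOrderTree.isWellOrder_Iio t
  intro p hp q hq _
  rcases trichotomous_of ((· < ·) : Iio t → Iio t → Prop) ⟨p, hp⟩ ⟨q, hq⟩ with h | h | h
  · exact Or.inl (le_of_lt h)
  · exact Or.inl (le_of_eq (congrArg Subtype.val h))
  · exact Or.inr (le_of_lt h)

/-- Finitely many conditions that hold eventually below `t` hold simultaneously. -/
theorem exists_lt_forall_mem [IsOrderTree T] {t : T}
    (ht : (Iio t).Nonempty) (F : Finset T) (p : T → T → Prop)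
    (hp : ∀ r ∈ F, ∃ s < t, ∀ s' < t, s ≤ s' → p r s') :
    ∃ s < t, ∀ s' < t, s ≤ s' → ∀ r ∈ F, p r s' := by
  classical
  induction F using Finset.induction_on with
  | empty =>
    obtain ⟨s, hs⟩ := ht
    exact ⟨s, hs, fun _ _ _ r hr => absurd hr (Finset.notMem_empty r)⟩
  | insert r F _ ih =>
    obtain ⟨s₁, hs₁, h₁⟩ := ih fun q hq => hp q (Finset.mem_insert_of_mem hq)
    obtain ⟨s₂, hs₂, h₂⟩ := hp r (Finset.mem_insert_self r F)
    obtain ⟨s, hs, h1s, h2s⟩ : ∃ s < t, s₁ ≤ s ∧ s₂ ≤ s := by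
      rcases (isChain_Iio t).total hs₁ hs₂ with h12 | h21
      · exact ⟨s₂, hs₂, h12, le_rfl⟩
      · exact ⟨s₁, hs₁, le_rfl, h21⟩
    refine ⟨s, hs, fun s' hs' hss' q hq => ?_⟩
    rcases Finset.mem_insert.1 hq with rfl | hq
    · exact h₂ s' hs' (h2s.trans hss')
    · exact h₁ s' hs' (h1s.trans hss') q hq

theorem height_eq_of_Iio_eq [IsOrderTree T] {s t : T} (h : Iio s = Iio t) :
    height s = height t := by
  have := IsOrderTree.isWellOrder_Iio s
  have := IsOrderTree.isWellOrder_Iio t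
  exact Ordinal.type_eq.2 ⟨⟨Equiv.setCongr h, Iff.rfl⟩⟩

variable [IsAronszajnTree T]

theorem countable_of_isChain {C : Set T} (hC : IsChain (· ≤ ·) C) : C.Countable := by
  obtain ⟨B, hB, hCB⟩ := hC.exists_maxChain
  exact (IsAronszajnTree.countable_branch B hB).mono hCB

theorem countable_setOf_Iio_eq (J : Set T) : {t : T | Iio t = J}.Countable := by
  rcases {t : T | Iio t = J}.eq_empty_or_nonempty with h | ⟨s, hs⟩
  · rw [h]; exact countable_empty
  · refine (IsAronszajnTree.countable_level (height s)).mono fun t ht => ?_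
    exact height_eq_of_Iio_eq (Eq.trans ht (Eq.symm hs))

/-- Only countably many nodes have all their predecessors in a given initial chain `C`: the set of
predecessors is `C` or that of some member of `C`, and countable levels do the rest. -/
theorem countable_setOf_Iio_subset {C : Set T} (hC : IsChain (· ≤ ·) C) (hl : IsLowerSet C) :
    {t : T | Iio t ⊆ C}.Countable := by
  have hsub : {t : T | Iio t ⊆ C} ⊆
      {t | Iio t = C} ∪ ⋃ r ∈ C, {t | Iio t = Iio r} := by
    intro t ht
    by_cases h : C ⊆ Iio t
    · exact Or.inl (ht.antisymm h)
    obtain ⟨c, hc, hct⟩ := not_subset.1 h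
    obtain ⟨r, hrc, hrt, hr⟩ := exists_minimal_notMem (Iio t) hct
    have hrC : r ∈ C := hl hrc hc
    refine Or.inr (mem_biUnion hrC (Subset.antisymm (fun q hq => ?_) hr))
    rcases hC.total (ht hq) hrC with hqr | hqr
    · exact lt_of_le_of_ne hqr fun h => hrt (h ▸ hq)
    · exact absurd (lt_of_le_of_lt hqr hq) hrt
  exact ((countable_setOf_Iio_eq C).union
    ((countable_of_isChain hC).biUnion fun r _ => countable_setOf_Iio_eq _)).mono hsub

end Tree

/-- Every point lies in a countable set that is closed under a given countable-valued operation. -/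
theorem exists_countable_closed {α : Type*} (Ψ : α → Set α) (hΨ : ∀ a, (Ψ a).Countable) (a₀ : α) :
    ∃ M : Set α, M.Countable ∧ a₀ ∈ M ∧ ∀ s ∈ M, Ψ s ⊆ M := by
  let S : ℕ → Set α := fun n => Nat.rec {a₀} (fun _ N => ⋃ s ∈ N, Ψ s) n
  have hS : ∀ n, (S n).Countable := fun n => by
    induction n with
    | zero => exact countable_singleton a₀
    | succ n ih => exact ih.biUnion fun s _ => hΨ s
  refine ⟨⋃ n, S n, countable_iUnion hS, mem_iUnion.2 ⟨0, rfl⟩, fun s hs r hr => ?_⟩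
  obtain ⟨n, hn⟩ := mem_iUnion.1 hs
  exact mem_iUnion.2 ⟨n + 1, mem_biUnion hn hr⟩

/-! ### Points of the Stone space as paths through the tree -/

namespace IsGeneratedByTree

open StoneSpace

variable {T : Type u} [PartialOrder T] {A : Type v} [BooleanAlgebra A] {a : T → A}

theorem isChain_setOf_le (h : IsGeneratedByTree a) {c : A} (hc : c ≠ ⊥) :
    IsChain (· ≤ ·) {q | c ≤ a q} := by
  intro p hp q hq _
  by_contra! hpq
  exact hc (le_bot_iff.1 (h.inf_eq_bot p q hpq.1 hpq.2 ▸ le_inf hq hp))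

theorem isLowerSet_setOf_le (h : IsGeneratedByTree a) (c : A) : IsLowerSet {q | c ≤ a q} :=
  fun p q hqp hp => le_trans hp (h.le_of_le q p hqp)

theorem isLowerSet_path (h : IsGeneratedByTree a) (x : StoneSpace A) :
    IsLowerSet {t | a t ∈ x.filter} :=
  fun p q hqp hp => basic_mono (h.le_of_le q p hqp) hp

theorem disjoint_basic (h : IsGeneratedByTree a) {s t : T} (hst : ¬ s ≤ t) (hts : ¬ t ≤ s) :
    Disjoint (basic (a s)) (basic (a t)) := by
  rw [disjoint_iff_inter_eq_empty, ← basic_inf, h.inf_eq_bot t s hts hst, basic_bot]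

theorem le_or_le_of_mem (h : IsGeneratedByTree a) {x : StoneSpace A} {s t : T}
    (hs : a s ∈ x.filter) (ht : a t ∈ x.filter) : s ≤ t ∨ t ≤ s := by
  by_contra! hst
  exact Set.disjoint_left.1 (h.disjoint_basic hst.1 hst.2) hs ht

/-- Membership of an element of the algebra in an ultrafilter depends only on finitely many nodes
of the associated path. -/
theorem exists_finset_support (h : IsGeneratedByTree a) (b : A) :
    ∃ F : Finset T, ∀ x y : StoneSpace A, (∀ r ∈ F, a r ∈ x.filter ↔ a r ∈ y.filter) →
      (b ∈ x.filter ↔ b ∈ y.filter) := by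
  classical
  have hb : b ∈ BooleanSubalgebra.closure (range a) := h.closure_eq_top ▸ BooleanSubalgebra.mem_top
  induction hb using BooleanSubalgebra.closure_bot_sup_induction with
  | mem b hb =>
    obtain ⟨t, rfl⟩ := hb
    exact ⟨{t}, fun x y hxy => hxy t (Finset.mem_singleton_self t)⟩
  | bot =>
    refine ⟨∅, fun x y _ => ?_⟩
    rw [← mem_basic, ← mem_basic, basic_bot]
    exact Iff.rfl
  | sup b _ c _ hb hc =>
    obtain ⟨F, hF⟩ := hb
    obtain ⟨G, hG⟩ := hc
    refine ⟨F ∪ G, fun x y hxy => ?_⟩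
    rw [← mem_basic, ← mem_basic, basic_sup]
    exact or_congr (hF x y fun r hr => hxy r (Finset.mem_union_left _ hr))
      (hG x y fun r hr => hxy r (Finset.mem_union_right _ hr))
  | compl b _ hb =>
    obtain ⟨F, hF⟩ := hb
    refine ⟨F, fun x y hxy => ?_⟩
    rw [x.compl_mem_iff, y.compl_mem_iff, hF x y hxy]

/-- A basic neighbourhood prescribes the path on a finite set of nodes. -/
theorem exists_finset_of_mem_nhds (h : IsGeneratedByTree a) {x : StoneSpace A}
    {W : Set (StoneSpace A)} (hW : W ∈ 𝓝 x) :
    ∃ F : Finset T, ∀ y : StoneSpace A, (∀ r ∈ F, a r ∈ y.filter ↔ a r ∈ x.filter) → y ∈ W := by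
  obtain ⟨_, ⟨b, rfl⟩, hxb, hbW⟩ := isTopologicalBasis_basic.mem_nhds_iff.1 hW
  obtain ⟨F, hF⟩ := h.exists_finset_support b
  exact ⟨F, fun y hy => hbW ((hF y x hy).2 hxb)⟩

/-- The Stone space of an Aronszajn algebra is first countable: a neighbourhood base at `x` is
obtained from the countable path of `x` together with the nodes lying immediately above it, which
all belong to one level. -/
theorem firstCountableTopology [IsAronszajnTree T] (h : IsGeneratedByTree a) :
    FirstCountableTopology (StoneSpace A) := by
  refine ⟨fun x => ?_⟩
  let P : Set T := {t | a t ∈ x.filter}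
  let G : Set T := P ∪ {r | Iio r = P}
  let N : T → Set (StoneSpace A) := fun r => {y | a r ∈ y.filter ↔ a r ∈ x.filter}
  have hPc : P.Countable := countable_of_isChain fun s hs t ht _ => h.le_or_le_of_mem hs ht
  have hG : G.Countable := hPc.union (countable_setOf_Iio_eq P)
  have hN : ∀ r, N r ∈ ⨅ q ∈ G, 𝓟 (N q) := by
    have hle : ∀ q ∈ G, N q ∈ ⨅ q ∈ G, 𝓟 (N q) := fun q hq =>
      mem_iInf_of_mem q (mem_iInf_of_mem hq (mem_principal_self _))
    intro r
    by_cases hr : r ∈ P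
    · exact hle r (Or.inl hr)
    obtain ⟨m, hmr, hm, hmP⟩ := exists_minimal_notMem P hr
    by_cases hPm : P ⊆ Iio m
    · refine mem_of_superset (hle m (Or.inr (hmP.antisymm hPm))) fun y hy => ?_
      exact iff_of_false (fun hy' => hm (hy.1 (h.isLowerSet_path y hmr hy'))) hr
    · obtain ⟨p, hp, hpm⟩ := not_subset.1 hPm
      refine mem_of_superset (hle p (Or.inl hp)) fun y hy => iff_of_false (fun hy' => ?_) hr
      rcases h.le_or_le_of_mem (hy.2 hp) (h.isLowerSet_path y hmr hy') with hpm' | hmp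
      · exact hpm (lt_of_le_of_ne hpm' fun e => hm (e ▸ hp))
      · exact hm (h.isLowerSet_path x hmp hp)
  have hnhds : 𝓝 x = ⨅ q ∈ G, 𝓟 (N q) := by
    refine le_antisymm (le_iInf₂ fun q _ => le_principal_iff.2 (setOf_iff_mem_nhds (a q) x)) ?_
    intro W hW
    obtain ⟨F, hF⟩ := h.exists_finset_of_mem_nhds hW
    refine mem_of_superset ((biInter_finset_mem F).2 fun r _ => hN r) fun y hy => ?_
    exact hF y fun r hr => mem_iInter₂.1 hy r hr
  have := hG.to_subtype
  rw [hnhds, iInf_subtype']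
  have : ∀ q : G, (𝓟 (N q)).IsCountablyGenerated := fun q => isCountablyGenerated_principal _
  infer_instance

/-- If the closure of `U` is contained in the open set `V`, then, with the exception of the
predecessors of finitely many nodes, every node lies inside `V` or outside `U`. -/
theorem exists_finset_separating (h : IsGeneratedByTree a) {U V : Set (StoneSpace A)}
    (hV : IsOpen V) (hUV : closure U ⊆ V) :
    ∃ F : Finset T, ∀ t, (∀ r ∈ F, ¬ t ≤ r) → basic (a t) ⊆ V ∨ Disjoint (basic (a t)) U := by
  obtain ⟨b, hUb, hbV⟩ := exists_basic_between isClosed_closure.isCompact hV hUV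
  obtain ⟨F, hF⟩ := h.exists_finset_support b
  refine ⟨F, fun t ht => ?_⟩
  have hmem : ∀ y ∈ basic (a t), ∀ r ∈ F, a r ∈ y.filter ↔ r ≤ t := fun y hy r hr =>
    ⟨fun hr' => (h.le_or_le_of_mem hr' hy).resolve_right (ht r hr),
      fun hrt => h.isLowerSet_path y hrt hy⟩
  by_cases hne : ∃ y ∈ basic (a t), y ∈ U
  · obtain ⟨y, hyt, hyU⟩ := hne
    refine Or.inl fun z hz => hbV ?_
    exact (hF z y fun r hr => (hmem z hz r hr).trans (hmem y hyt r hr).symm).2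
      (hUb (subset_closure hyU))
  · push Not at hne
    exact Or.inr (Set.disjoint_left.2 hne)

end IsGeneratedByTree

/-! ### Chains of open sets -/

section Chain

variable {X : Type v} [TopologicalSpace X] {𝓤 : Set (Set X)}

theorem IsOpenChain.closure_subset (h : IsOpenChain 𝓤) {U V : Set X} (hU : U ∈ 𝓤) (hV : V ∈ 𝓤)
    (hVU : ¬ V ⊆ U) : closure U ⊆ V := by
  rcases h.2 U hU V hV with (h | h) | (h | h)
  · exact h
  · exact absurd h.ge hVU
  · exact absurd (subset_closure.trans h) hVU
  · exact absurd h.le hVU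

theorem IsOpenChain.subset_of_not_subset (h : IsOpenChain 𝓤) {U V : Set X} (hU : U ∈ 𝓤)
    (hV : V ∈ 𝓤) (hVU : ¬ V ⊆ U) : U ⊆ V :=
  subset_closure.trans (h.closure_subset hU hV hVU)

theorem IsOpenChain.disjoint_frontier (h : IsOpenChain 𝓤) {U V : Set X} (hU : U ∈ 𝓤)
    (hV : V ∈ 𝓤) (hUV : U ≠ V) : Disjoint (frontier U) (frontier V) := by
  wlog hVU : ¬ V ⊆ U generalizing U V
  · refine (this hV hU hUV.symm fun hUV' => hUV (hUV'.antisymm ?_)).symm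
    exact not_not.1 hVU
  rw [(h.1 V hV).frontier_eq]
  exact disjoint_sdiff_right.mono_left (frontier_subset_closure.trans (h.closure_subset hU hV hVU))

/-- Every nonempty open set meets the boundaries of infinitely many members of a tunnel, because
finitely many boundaries of open sets have a nowhere dense union. -/
theorem IsTunnel.infinite_setOf_frontier_inter_nonempty (h : IsTunnel 𝓤) {N : Set X}
    (hN : IsOpen N) (hne : N.Nonempty) : {U ∈ 𝓤 | (frontier U ∩ N).Nonempty}.Infinite := by
  intro hfin
  have hdense := (hfin.image fun U => (frontier U)ᶜ).dense_sInter
    (by rintro _ ⟨U, -, rfl⟩; exact isClosed_frontier.isOpen_compl)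
    (by
      rintro _ ⟨U, hU, rfl⟩
      rw [← interior_eq_empty_iff_dense_compl, ← frontier_compl]
      exact interior_frontier (h.1.1 U hU.1).isClosed_compl)
  have hopen : IsOpen (⋂₀ ((fun U => (frontier U)ᶜ) '' {U ∈ 𝓤 | (frontier U ∩ N).Nonempty})) :=
    (hfin.image _).isOpen_sInter
      (by rintro _ ⟨U, -, rfl⟩; exact isClosed_frontier.isOpen_compl)
  obtain ⟨x, ⟨hxN, hx⟩, hxU⟩ := h.2.inter_open_nonempty _ (hN.inter hopen)
    (hdense.inter_open_nonempty N hN hne)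
  obtain ⟨U, hU, hxU⟩ := mem_iUnion₂.1 hxU
  exact hx _ ⟨U, ⟨hU, x, hxU, hxN⟩, rfl⟩ hxU

variable [CompactSpace X] [FirstCountableTopology X]

/-- In a compact first countable space there is no strictly increasing `ω₁`-sequence in a chain of
open sets: a sequence converging to a boundary point of the union would be absorbed by one term. -/
theorem IsOpenChain.exists_countable_cofinal (h : IsOpenChain 𝓤) {𝓥 : Set (Set X)} (h𝓥 : 𝓥 ⊆ 𝓤) :
    ∃ 𝓒 ⊆ 𝓥, 𝓒.Countable ∧ ∀ U ∈ 𝓥, ∃ V ∈ 𝓒, U ⊆ V := by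
  by_cases hmax : ∃ V ∈ 𝓥, ∀ U ∈ 𝓥, U ⊆ V
  · obtain ⟨V, hV, hmax⟩ := hmax
    exact ⟨{V}, singleton_subset_iff.2 hV, countable_singleton V, fun U hU => ⟨V, rfl, hmax U hU⟩⟩
  push Not at hmax
  rcases 𝓥.eq_empty_or_nonempty with rfl | hne
  · exact ⟨∅, le_rfl, countable_empty, fun U hU => hU.elim⟩
  have hclosed : ¬ IsClosed (⋃₀ 𝓥) := by
    intro hcl
    have := hne.to_subtype
    obtain ⟨V, hV⟩ := hcl.isCompact.elim_directed_cover (fun V : 𝓥 => (V : Set X))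
      (fun V => h.1 V (h𝓥 V.2)) (sUnion_eq_iUnion).le (by
        intro U V
        by_cases hUV : (U : Set X) ⊆ V
        · exact ⟨V, hUV, le_rfl⟩
        · exact ⟨U, le_rfl, h.subset_of_not_subset (h𝓥 V.2) (h𝓥 U.2) hUV⟩)
    obtain ⟨U, hU, hUV⟩ := hmax V V.2
    exact hUV ((subset_sUnion_of_mem hU).trans hV)
  obtain ⟨x, hx, hxn⟩ : ∃ x ∈ closure (⋃₀ 𝓥), x ∉ ⋃₀ 𝓥 := by
    by_contra! hcon
    exact hclosed (closure_subset_iff_isClosed.1 hcon)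
  obtain ⟨B, hB⟩ := (𝓝 x).exists_antitone_basis
  have hmeet : ∀ n, ∃ V ∈ 𝓥, (B n ∩ V).Nonempty := by
    intro n
    obtain ⟨y, hyB, V, hV, hyV⟩ := mem_closure_iff_nhds.1 hx _ (hB.mem n)
    exact ⟨V, hV, y, hyB, hyV⟩
  choose V hV hBV using hmeet
  refine ⟨range V, range_subset_iff.2 hV, countable_range V, fun U hU => ?_⟩
  by_contra! hcon
  have hxU : x ∈ closure U := by
    refine mem_closure_iff_nhds.2 fun W hW => ?_
    obtain ⟨n, hn⟩ := hB.mem_iff.1 hW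
    refine (hBV n).mono (inter_subset_inter hn ?_)
    exact h.subset_of_not_subset (h𝓥 (hV n)) (h𝓥 hU) (hcon _ ⟨n, rfl⟩)
  obtain ⟨U', hU', hUU'⟩ := hmax U hU
  exact hxn ⟨U', hU', h.closure_subset (h𝓥 hU) (h𝓥 hU') hUU' hxU⟩

/-- The dual of `IsOpenChain.exists_countable_cofinal`. -/
theorem IsOpenChain.exists_countable_coinitial (h : IsOpenChain 𝓤) {𝓥 : Set (Set X)}
    (h𝓥 : 𝓥 ⊆ 𝓤) : ∃ 𝓒 ⊆ 𝓥, 𝓒.Countable ∧ ∀ U ∈ 𝓥, ∃ V ∈ 𝓒, V ⊆ U := by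
  by_cases hmin : ∃ V ∈ 𝓥, ∀ U ∈ 𝓥, V ⊆ U
  · obtain ⟨V, hV, hmin⟩ := hmin
    exact ⟨{V}, singleton_subset_iff.2 hV, countable_singleton V, fun U hU => ⟨V, rfl, hmin U hU⟩⟩
  push Not at hmin
  rcases 𝓥.eq_empty_or_nonempty with rfl | hne
  · exact ⟨∅, le_rfl, countable_empty, fun U hU => hU.elim⟩
  have hcl : ∀ U ∈ 𝓥, ∃ V ∈ 𝓥, closure V ⊆ U := fun U hU =>
    let ⟨V, hV, hUV⟩ := hmin U hU
    ⟨V, hV, h.closure_subset (h𝓥 hV) (h𝓥 hU) hUV⟩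
  -- The intersection is also that of the closures, so it is compact but not open.
  have hopen : ¬ IsOpen (⋂₀ 𝓥) := by
    intro ho
    have := hne.to_subtype
    obtain ⟨V, hV⟩ := exists_subset_nhds_of_isCompact' (V := fun V : 𝓥 => closure (V : Set X))
      (U := ⋂₀ 𝓥) (by
        intro U V
        by_cases hUV : (U : Set X) ⊆ V
        · exact ⟨U, le_rfl, closure_mono hUV⟩
        · exact ⟨V, closure_mono (h.subset_of_not_subset (h𝓥 V.2) (h𝓥 U.2) hUV), le_rfl⟩)
      (fun V => isClosed_closure.isCompact) (fun V => isClosed_closure) (by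
        intro x hx
        refine ho.mem_nhds fun U hU => ?_
        obtain ⟨V, hV, hVU⟩ := hcl U hU
        exact hVU (mem_iInter.1 hx ⟨V, hV⟩))
    obtain ⟨U, hU, hVU⟩ := hmin V V.2
    exact hVU (subset_closure.trans (hV.trans (sInter_subset_of_mem hU)))
  obtain ⟨x, hx, hxn⟩ : ∃ x ∈ ⋂₀ 𝓥, ⋂₀ 𝓥 ∉ 𝓝 x := by
    by_contra! hcon
    exact hopen (isOpen_iff_mem_nhds.2 hcon)
  obtain ⟨B, hB⟩ := (𝓝 x).exists_antitone_basis
  have hmeet : ∀ n, ∃ V ∈ 𝓥, ¬ B n ⊆ V := by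
    intro n
    by_contra! hcon
    exact hxn (mem_of_superset (hB.mem n) (subset_sInter hcon))
  choose V hV hBV using hmeet
  refine ⟨range V, range_subset_iff.2 hV, countable_range V, fun U hU => ?_⟩
  by_contra! hcon
  obtain ⟨n, hn⟩ := hB.mem_iff.1 ((h.1 U (h𝓥 hU)).mem_nhds (hx U hU))
  exact hBV n (hn.trans (h.subset_of_not_subset (h𝓥 hU) (h𝓥 (hV n)) (hcon _ ⟨n, rfl⟩)))

end Chain

/-! ### Limit nodes -/

namespace IsGeneratedByTree

open StoneSpace

variable {T : Type u} [PartialOrder T] {A : Type v} [BooleanAlgebra A] {a : T → A}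

/-- Closing off a countable set of nodes under a countable-valued operation `Ψ` and passing to a
minimal node `t` outside gives a node of limit height for which the elements `a s`, `s < t`, do not
stabilise. This replaces the choice of an elementary submodel. -/
theorem exists_limit_node [IsAronszajnTree T] (h : IsGeneratedByTree a) (Ψ : T → Set T)
    (hΨ : ∀ s, (Ψ s).Countable) :
    ∃ (M : Set T) (t : T), (∀ s ∈ M, Ψ s ⊆ M) ∧ Iio t ⊆ M ∧ (Iio t).Nonempty ∧
      ∀ r ∈ M, ∃ s < t, ¬ a r ≤ a s := by
  have hunc := IsAronszajnTree.uncountable (T := T)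
  obtain ⟨t₀⟩ : Nonempty T := inferInstance
  obtain ⟨M, hMc, ht₀, hM⟩ := exists_countable_closed
    (fun s => Ψ s ∪ {t | Iio t ⊆ {q | a s ≤ a q}})
    (fun s => (hΨ s).union
      (countable_setOf_Iio_subset (h.isChain_setOf_le (h.ne_bot s)) (h.isLowerSet_setOf_le _))) t₀
  obtain ⟨t₁, ht₁⟩ : ∃ t₁, t₁ ∉ M := by
    by_contra! hcon
    exact not_countable_univ ((eq_univ_of_forall hcon) ▸ hMc)
  obtain ⟨t, -, ht, htM⟩ := exists_minimal_notMem M ht₁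
  have hlim : ∀ r ∈ M, ∃ s < t, ¬ a r ≤ a s := by
    intro r hr
    by_contra! hcon
    exact ht (hM r hr (Or.inr hcon))
  obtain ⟨s, hs, -⟩ := hlim t₀ ht₀
  exact ⟨M, t, fun s hs => subset_union_left.trans (hM s hs), htM, ⟨s, hs⟩, hlim⟩

/-- At a limit node `t` the closed set `⋂ s < t, basic (a s)` is not open. The path of any of its
boundary points `x` is `Iio t`, so that the sets `basic (a s)`, `s < t`, shrink to `x` outside of
that intersection. -/
theorem exists_boundary_point [IsOrderTree T] (h : IsGeneratedByTree a) {t : T}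
    (ht : (Iio t).Nonempty) (hlim : ∀ r < t, ∃ s < t, ¬ a r ≤ a s) :
    ∃ x : StoneSpace A, ∀ W ∈ 𝓝 x, ∃ s < t, basic (a s) \ ⋂ r ∈ Iio t, basic (a r) ⊆ W := by
  set E : Set (StoneSpace A) := ⋂ r ∈ Iio t, basic (a r) with hE
  have hnotopen : ¬ IsOpen E := by
    intro ho
    have := ht.to_subtype
    obtain ⟨s, hs⟩ := exists_subset_nhds_of_isCompact'
      (V := fun s : Iio t => basic (a s)) (U := E) (by
        intro p q
        rcases (isChain_Iio t).total p.2 q.2 with hpq | hqp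
        · exact ⟨q, basic_mono (h.le_of_le _ _ hpq), le_rfl⟩
        · exact ⟨p, le_rfl, basic_mono (h.le_of_le _ _ hqp)⟩)
      (fun s => (isClosed_basic _).isCompact) (fun s => isClosed_basic _) (by
        intro x hx
        exact ho.mem_nhds (mem_iInter₂.2 fun r hr => mem_iInter.1 hx ⟨r, hr⟩))
    obtain ⟨r, hr, hsr⟩ := hlim s s.2
    exact hsr (basic_subset_basic.1 (hs.trans (biInter_subset_of_mem hr)))
  obtain ⟨x, hx, hxn⟩ : ∃ x ∈ E, E ∉ 𝓝 x := by
    by_contra! hcon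
    exact hnotopen (isOpen_iff_mem_nhds.2 hcon)
  refine ⟨x, fun W hW => ?_⟩
  obtain ⟨F, hF⟩ := h.exists_finset_of_mem_nhds hW
  obtain ⟨s, hs, hsF⟩ := exists_lt_forall_mem ht F
    (fun r s => ∀ y ∈ basic (a s) \ E, a r ∈ y.filter ↔ a r ∈ x.filter) (by
      intro r _
      by_cases hrt : r < t
      · exact ⟨r, hrt, fun s' _ hrs' y hy => iff_of_true (h.isLowerSet_path y hrs' hy.1)
          (mem_iInter₂.1 hx r hrt)⟩
      by_cases hrE : ∀ p < t, p ≤ r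
      · have hsub : basic (a r) ⊆ E :=
          subset_iInter₂ fun p hp => basic_mono (h.le_of_le p r (hrE p hp))
        obtain ⟨p, hp⟩ := ht
        refine ⟨p, hp, fun s' _ _ y hy => iff_of_false (fun hy' => hy.2 (hsub hy')) fun hxr => ?_⟩
        exact hxn (mem_of_superset ((isOpen_basic _).mem_nhds hxr) hsub)
      · push Not at hrE
        obtain ⟨p, hp, hpr⟩ := hrE
        have hrp : ¬ r ≤ p := fun hrp => hrt (lt_of_le_of_lt hrp hp)
        have hdisj := Set.disjoint_left.1 (h.disjoint_basic hpr hrp)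
        exact ⟨p, hp, fun s' _ hps' y hy => iff_of_false
          (hdisj (h.isLowerSet_path y hps' hy.1)) (hdisj (mem_iInter₂.1 hx p hp))⟩)
  exact ⟨s, hs, fun y hy => hF y fun r hr => hsF s hs le_rfl r hr y hy⟩

/-! ### Absence of tunnels -/

/-- At a suitable limit node `t`, at most three members of a chain of open sets have boundaries that
meet `basic (a t)`: at most one with `x` inside, one with `x` on the boundary and one with `x`
outside the closure, where `x` is the point of `exists_boundary_point`. -/
theorem not_isTunnel [IsAronszajnTree T] (h : IsGeneratedByTree a) (𝓤 : Set (Set (StoneSpace A))) :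
    ¬ IsTunnel 𝓤 := by
  intro htun
  have hch := htun.1
  have := h.firstCountableTopology
  choose! F hF using fun (U V : Set (StoneSpace A)) (hUV : IsOpen V ∧ closure U ⊆ V) =>
    h.exists_finset_separating hUV.1 hUV.2
  choose C hCsub hCc hC using fun s : T =>
    hch.exists_countable_cofinal (sep_subset 𝓤 fun U => ¬ basic (a s) ⊆ U)
  choose D hDsub hDc hD using fun s : T =>
    hch.exists_countable_coinitial (sep_subset 𝓤 fun U => ¬ Disjoint (basic (a s)) U)
  choose C' hCsub' hCc' hC' using fun V : Set (StoneSpace A) =>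
    hch.exists_countable_cofinal (sep_subset 𝓤 fun U => ¬ V ⊆ U)
  choose D' hDsub' hDc' hD' using fun V : Set (StoneSpace A) =>
    hch.exists_countable_coinitial (sep_subset 𝓤 fun U => ¬ U ⊆ V)
  obtain ⟨M, t, hM, htM, htne, hlim⟩ := h.exists_limit_node
    (fun s => (⋃ V ∈ C s, ⋃ V' ∈ C' V, F V' V) ∪ ⋃ V ∈ D s, ⋃ V' ∈ D' V, F V V')
    (fun s => ((hCc s).biUnion fun V _ => (hCc' V).biUnion fun V' _ => (F V' V).countable_toSet).union
      ((hDc s).biUnion fun V _ => (hDc' V).biUnion fun V' _ => (F V V').countable_toSet))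
  obtain ⟨x, hx⟩ := h.exists_boundary_point htne fun r hr => hlim r (htM hr)
  have hbelow : ∀ s < t, basic (a t) ⊆ basic (a s) := fun s hs =>
    basic_mono (h.le_of_le s t hs.le)
  have htE : basic (a t) ⊆ ⋂ r ∈ Iio t, basic (a r) := subset_iInter₂ hbelow
  -- The nodes below `t` are eventually decided by a separating set contained in `M`.
  have hdecide : ∀ U V : Set (StoneSpace A), IsOpen V → closure U ⊆ V → (∀ r ∈ F U V, r ∈ M) →
      (⋂ r ∈ Iio t, basic (a r)) ⊆ V ∨ Disjoint (⋂ r ∈ Iio t, basic (a r)) U := by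
    intro U V hV hUV hFM
    obtain ⟨s, hs, hsF⟩ := exists_lt_forall_mem htne (F U V) (fun r s => ¬ s ≤ r) (by
      intro r hr
      obtain ⟨s, hs, hrs⟩ := hlim r (hFM r hr)
      exact ⟨s, hs, fun s' _ hss' hs'r => hrs (h.le_of_le s r (hss'.trans hs'r))⟩)
    have hEs : (⋂ r ∈ Iio t, basic (a r)) ⊆ basic (a s) := biInter_subset_of_mem hs
    exact (hF U V ⟨hV, hUV⟩ s (hsF s hs le_rfl)).imp hEs.trans fun hd => hd.mono_left hEs
  have hmeet : ∀ U ∈ 𝓤, (frontier U ∩ basic (a t)).Nonempty → ¬ Disjoint (basic (a t)) U := by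
    rintro U hU ⟨y, hyU, hyt⟩ hd
    obtain ⟨z, hzt, hzU⟩ := mem_closure_iff_nhds.1 (frontier_subset_closure hyU) _
      ((isOpen_basic _).mem_nhds hyt)
    exact Set.disjoint_left.1 hd hzt hzU
  have hnsub : ∀ U ∈ 𝓤, (frontier U ∩ basic (a t)).Nonempty → ¬ basic (a t) ⊆ U := by
    rintro U hU ⟨y, hyU, hyt⟩ hsub
    rw [(hch.1 U hU).frontier_eq] at hyU
    exact hyU.2 (hsub hyt)
  have hinside : {U ∈ 𝓤 | (frontier U ∩ basic (a t)).Nonempty ∧ x ∈ U}.Subsingleton := by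
    -- It suffices to exclude two such sets with `U' ⊈ U`, that is, `U` strictly inside `U'`.
    suffices key : ∀ U ∈ 𝓤, ∀ U' ∈ 𝓤, (frontier U ∩ basic (a t)).Nonempty →
        (frontier U' ∩ basic (a t)).Nonempty → x ∈ U → U' ⊆ U by
      exact fun U hU U' hU' =>
        (key U' hU'.1 U hU.1 hU'.2.1 hU.2.1 hU'.2.2).antisymm
          (key U hU.1 U' hU'.1 hU.2.1 hU'.2.1 hU.2.2)
    intro U hU U' hU' hUt hUt' hxU
    by_contra hUU'
    obtain ⟨s, hs, hsU⟩ := hx U ((hch.1 U hU).mem_nhds hxU)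
    obtain ⟨V, hV, hUV⟩ := hC s U' ⟨hU', fun hsub => hnsub U' hU' hUt' ((hbelow s hs).trans hsub)⟩
    obtain ⟨hV𝓤, hsV⟩ := hCsub s hV
    obtain ⟨V', hV', hUV'⟩ := hC' V U ⟨hU, fun hVU => hUU' (hUV.trans hVU)⟩
    obtain ⟨hV𝓤', hVV'⟩ := hCsub' V hV'
    rcases hdecide V' V (hch.1 V hV𝓤) (hch.closure_subset hV𝓤' hV𝓤 hVV') (fun r hr =>
      hM s (htM hs) (Or.inl (mem_biUnion hV (mem_biUnion hV' hr)))) with hE | hE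
    · refine hsV fun y hy => ?_
      by_cases hyE : y ∈ ⋂ r ∈ Iio t, basic (a r)
      · exact hE hyE
      · exact hUV (hch.subset_of_not_subset hU hU' hUU' (hsU ⟨hy, hyE⟩))
    · exact hmeet U hU hUt (hE.mono htE hUV')
  have houtside : {U ∈ 𝓤 | (frontier U ∩ basic (a t)).Nonempty ∧ x ∉ closure U}.Subsingleton := by
    suffices key : ∀ U ∈ 𝓤, ∀ U' ∈ 𝓤, (frontier U ∩ basic (a t)).Nonempty →
        (frontier U' ∩ basic (a t)).Nonempty → x ∉ closure U → U ⊆ U' by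
      exact fun U hU U' hU' =>
        (key U hU.1 U' hU'.1 hU.2.1 hU'.2.1 hU.2.2).antisymm
          (key U' hU'.1 U hU.1 hU'.2.1 hU.2.1 hU'.2.2)
    intro U hU U' hU' hUt hUt' hxU
    by_contra hUU'
    obtain ⟨s, hs, hsU⟩ := hx _ (isClosed_closure.isOpen_compl.mem_nhds hxU)
    obtain ⟨V, hV, hUV⟩ := hD s U' ⟨hU', fun hd => hmeet U' hU' hUt' (hd.mono_left (hbelow s hs))⟩
    obtain ⟨hV𝓤, hsV⟩ := hDsub s hV
    obtain ⟨V', hV', hUV'⟩ := hD' V U ⟨hU, fun hVU => hUU' (hVU.trans hUV)⟩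
    obtain ⟨hV𝓤', hVV'⟩ := hDsub' V hV'
    rcases hdecide V V' (hch.1 V' hV𝓤') (hch.closure_subset hV𝓤 hV𝓤' hVV') (fun r hr =>
      hM s (htM hs) (Or.inr (mem_biUnion hV (mem_biUnion hV' hr)))) with hE | hE
    · exact hnsub U hU hUt ((htE.trans hE).trans hUV')
    · refine hsV (Set.disjoint_left.2 fun y hy hyV => ?_)
      by_cases hyE : y ∈ ⋂ r ∈ Iio t, basic (a r)
      · exact Set.disjoint_left.1 hE hyE hyV
      · exact hsU ⟨hy, hyE⟩
          (subset_closure (hch.subset_of_not_subset hU' hU hUU' (hUV hyV)))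
  have hfrontier : {U ∈ 𝓤 | x ∈ frontier U}.Subsingleton := by
    intro U hU U' hU'
    by_contra hne
    exact Set.disjoint_left.1 (hch.disjoint_frontier hU.1 hU'.1 hne) hU.2 hU'.2
  refine htun.infinite_setOf_frontier_inter_nonempty (isOpen_basic (a t))
    (basic_nonempty (h.ne_bot t)) (((hinside.finite.union houtside.finite).union
      hfrontier.finite).subset ?_)
  rintro U ⟨hU, hUt⟩
  by_cases hxU : x ∈ U
  · exact Or.inl (Or.inl ⟨hU, hUt, hxU⟩)
  by_cases hxcl : x ∈ closure U
  · refine Or.inr ⟨hU, ?_⟩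
    rw [(hch.1 U hU).frontier_eq]
    exact ⟨hxcl, hxU⟩
  · exact Or.inl (Or.inr ⟨hU, hUt, hxcl⟩)

end IsGeneratedByTree

end AronszajnAlgebra

theorem theorem2p14 (A : Type v) [BooleanAlgebra A]
    (hA : AronszajnAlgebra.IsAronszajnAlgebra.{u, v} A) :
    ¬ AronszajnAlgebra.HasTunnel (AronszajnAlgebra.StoneSpace A) := by
  obtain ⟨T, _, _, a, ha⟩ := hA
  rintro ⟨𝓤, h𝓤⟩
  exact ha.not_isTunnel 𝓤 h𝓤
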